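/- **Conventions.** All Hilbert spaces are complex. A bounded operator $T$ on a Hilbert space is *Fredholm* if its range is closed and $\ker T$, $\operatorname{coker} T=H/\operatorname{Ran}T$ are finite-dimensional, and then $\operatorname{Ind}T=\dim\ker T-\dim\operatorname{coker}T$. Let $\mathcal T=(A_1,\dots,A_n)$ be a tuple of pairwise commuting bounded operators on a Hilbert space $H$, and let $e_1,\dots,e_n$ be the standard basis of $\mathbb C^n$. The Koszul complex of $\mathcal T$ has chains $K_p=H\otimes\Lambda^p(\mathbb C^n)$, $0\le p\le n$, and boundary operators $$\partial(\xi\otimes e_{s_1}\wedge\cdots\wedge e_{s_p})=\sum_{k=1}^p(-1)^{k-1}A_{s_k}\xi\otimes e_{s_1}\wedge\cdots\wedge\widehat{e_{s_k}}\wedge\cdots\wedge e_{s_p},\qquad \xi\in H,\ s_1<\dots<s_p .$$ Let $H_p(\mathcal T)=\ker(\partial|_{K_p})/\partial(K_{p+1})$ be its homology. The tuple $\mathcal T$ is *Fredholm* if $\dim H_p(\mathcal T)<\infty$ for all $0\le p\le n$, and then $$\operatorname{Ind}\mathcal T=\sum_{p=0}^n(-1)^{p+1}\dim H_p(\mathcal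 T).$$ **Lemma.** Let $H_1,\dots,H_n$ be infinite-dimensional Hilbert spaces, let $H=H_1\otimes\cdots\otimes H_n$ be their Hilbert space tensor product, and let $T_i\in L(H_i)$, $1\le i\le n$, be bounded operators none of which is invertible. Put $$\widetilde T_i=I_{H_1}\otimes\cdots\otimes I_{H_{i-1}}\otimes T_i\otimes I_{H_{i+1}}\otimes\cdots\otimes I_{H_n},\qquad 1\le i\le n .$$ Then the tuple $\mathcal T=(\widetilde T_1,\dots,\widetilde T_n)$ is Fredholm on $H$ if and only if every $T_i$ is Fredholm. In this case $$\operatorname{Ind}\mathcal T=(-1)^{n+1}\prod_{i=1}^n\operatorname{Ind}T_i .$$ -/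

import Mathlib

noncomputable section

/-! ### The Hilbert space tensor product of finitely many Hilbert spaces -/

section TensorProduct

open scoped InnerProductSpace ComplexOrder

variable {ι : Type*} (H : ι → Type*)
  [∀ i, NormedAddCommGroup (H i)] [∀ i, InnerProductSpace ℂ (H i)]

/-- The algebraic tensor product of the spaces `H i` over `ℂ`. (A separate name for the type
`⨂[ℂ] i, H i`, because the norm that Mathlib puts on the latter is the projective one.) -/
def AlgTensor : Type _ := PiTensorProduct ℂ H

namespace AlgTensor

instance : AddCommGroup (AlgTensor H) := inferInstanceAs (AddCommGroup (PiTensorProduct ℂ H))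

instance : Module ℂ (AlgTensor H) := inferInstanceAs (Module ℂ (PiTensorProduct ℂ H))

variable {H}

/-- The elementary tensor `x₁ ⊗ ⋯ ⊗ xₙ`. -/
def tmul (x : ∀ i, H i) : AlgTensor H := PiTensorProduct.tprod ℂ x

theorem induction {p : AlgTensor H → Prop} (z : AlgTensor H)
    (smul : ∀ (c : ℂ) (x : ∀ i, H i), p (c • tmul x))
    (add : ∀ x y, p x → p y → p (x + y)) : p z :=
  PiTensorProduct.induction_on z smul add

theorem antilinear_ext {f g : AlgTensor H →ₗ⋆[ℂ] ℂ} (h : ∀ x, f (tmul x) = g (tmul x)) :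
    f = g := by
  ext z
  induction z using induction with
  | smul c x => simp [h]
  | add x y hx hy => simp [hx, hy]

theorem exists_sum (z : AlgTensor H) :
    ∃ (m : ℕ) (c : Fin m → ℂ) (v : Fin m → ∀ i, H i), z = ∑ k, c k • tmul (v k) := by
  induction z using induction with
  | smul c x => exact ⟨1, fun _ => c, fun _ => x, by simp⟩
  | add x y hx hy =>
    obtain ⟨m, c, v, rfl⟩ := hx
    obtain ⟨m', c', v', rfl⟩ := hy
    exact ⟨m + m', Fin.append c c', Fin.append v v', by simp [Fin.sum_univ_add]⟩

section

variable [DecidableEq ι]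

/-- `I ⊗ ⋯ ⊗ T ⊗ ⋯ ⊗ I` (with `T` in position `i`) on the algebraic tensor product. -/
def siteₗ (i : ι) (T : H i →L[ℂ] H i) : AlgTensor H →ₗ[ℂ] AlgTensor H :=
  PiTensorProduct.map (Function.update (fun _ => LinearMap.id) i (T : H i →ₗ[ℂ] H i))

theorem siteₗ_tmul (i : ι) (T : H i →L[ℂ] H i) (x : ∀ j, H j) :
    siteₗ i T (tmul x) = tmul (Function.update x i (T (x i))) := by
  refine (PiTensorProduct.map_tprod _ x).trans ?_
  refine congrArg (PiTensorProduct.tprod ℂ) (funext fun j => ?_)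
  by_cases h : j = i
  · subst h; simp
  · simp [h]

end

variable [Fintype ι]

/-- The linear functional `y ↦ ∏ i, ⟪w i, y i⟫` on elementary tensors. -/
def innerLeft (w : ∀ i, H i) : AlgTensor H →ₗ[ℂ] ℂ :=
  PiTensorProduct.lift
    ((MultilinearMap.mkPiAlgebra ℂ ι ℂ).compLinearMap fun i => innerₛₗ ℂ (w i))

theorem innerLeft_tmul (w y : ∀ i, H i) : innerLeft w (tmul y) = ∏ i, ⟪w i, y i⟫_ℂ := by
  refine (PiTensorProduct.lift.tprod y).trans ?_
  simp

/-- The antilinear functional `x ↦ ∏ i, ⟪x i, w i⟫` on elementary tensors. -/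
def innerRight (w : ∀ i, H i) : AlgTensor H →ₗ⋆[ℂ] ℂ where
  toFun x := starRingEnd ℂ (innerLeft w x)
  map_add' x y := by simp
  map_smul' c x := by simp

theorem innerRight_tmul (w x : ∀ i, H i) : innerRight w (tmul x) = ∏ i, ⟪x i, w i⟫_ℂ := by
  simp [innerRight, innerLeft_tmul, map_prod, inner_conj_symm]

/-- `innerRight` as a multilinear map in `w`. -/
def innerMulti : MultilinearMap ℂ H (AlgTensor H →ₗ⋆[ℂ] ℂ) where
  toFun := innerRight
  map_update_add' w i a b := by
    refine antilinear_ext fun x => ?_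
    simp only [LinearMap.add_apply, innerRight_tmul]
    rw [Fintype.prod_eq_mul_prod_compl i, Fintype.prod_eq_mul_prod_compl i,
      Fintype.prod_eq_mul_prod_compl i]
    simp only [Function.update_self, inner_add_right, add_mul]
    congr 2 <;>
    · refine Finset.prod_congr rfl fun j hj => ?_
      have : j ≠ i := by simpa using hj
      simp [this]
  map_update_smul' w i c a := by
    refine antilinear_ext fun x => ?_
    simp only [LinearMap.smul_apply, innerRight_tmul]
    rw [Fintype.prod_eq_mul_prod_compl i, Fintype.prod_eq_mul_prod_compl i]
    simp only [Function.update_self, inner_smul_right, smul_eq_mul, mul_assoc]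
    congr 2
    refine Finset.prod_congr rfl fun j hj => ?_
    have : j ≠ i := by simpa using hj
    simp [this]

variable (H) in
/-- The sesquilinear form on the algebraic tensor product that is determined by
`⟪x₁ ⊗ ⋯ ⊗ xₙ, y₁ ⊗ ⋯ ⊗ yₙ⟫ = ∏ i, ⟪x i, y i⟫`; it is antilinear in `x`, and the arguments are
taken in the order `form y x`. -/
def form : AlgTensor H →ₗ[ℂ] AlgTensor H →ₗ⋆[ℂ] ℂ := PiTensorProduct.lift innerMulti

theorem form_tmul_tmul (x y : ∀ i, H i) :
    form H (tmul y) (tmul x) = ∏ i, ⟪x i, y i⟫_ℂ := by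
  rw [← innerRight_tmul]
  exact congrArg (fun f : AlgTensor H →ₗ⋆[ℂ] ℂ => f (tmul x))
    (PiTensorProduct.lift.tprod (φ := innerMulti) y)

theorem posSemidef_prod {m : ℕ} {κ : Type*} (s : Finset κ) (A : κ → Matrix (Fin m) (Fin m) ℂ)
    (hA : ∀ i ∈ s, (A i).PosSemidef) :
    (Matrix.of fun k l => ∏ i ∈ s, A i k l).PosSemidef := by
  classical
  induction s using Finset.induction_on with
  | empty =>
    convert Matrix.posSemidef_vecMulVec_self_star (fun _ : Fin m => (1 : ℂ)) using 1
    ext k l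
    simp [Matrix.vecMulVec]
  | insert a s ha ih =>
    have h : (Matrix.of fun k l => ∏ i ∈ insert a s, A i k l) =
        (A a).hadamard (Matrix.of fun k l => ∏ i ∈ s, A i k l) := by
      ext k l
      simp [Finset.prod_insert ha]
    rw [h]
    exact (hA a (by simp)).hadamard (ih fun i hi => hA i (by simp [hi]))

theorem form_sum {m : ℕ} (c : Fin m → ℂ) (v : Fin m → ∀ i, H i) :
    form H (∑ k, c k • tmul (v k)) (∑ k, c k • tmul (v k)) =
      star c ⬝ᵥ ((Matrix.of fun k l => ∏ i, Matrix.gram ℂ (fun k => v k i) k l).mulVec c) := by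
  simp only [map_sum, map_smul, LinearMap.sum_apply, LinearMap.smul_apply, LinearMap.map_smulₛₗ,
    form_tmul_tmul, dotProduct, Matrix.mulVec, Matrix.of_apply, Matrix.gram_apply, smul_eq_mul,
    Finset.mul_sum, Pi.star_apply]
  refine Finset.sum_congr rfl fun k _ => Finset.sum_congr rfl fun l _ => ?_
  simp only [starRingEnd_apply]
  ring

theorem form_conj_symm (x y : AlgTensor H) : starRingEnd ℂ (form H x y) = form H y x := by
  induction x using induction with
  | smul c x =>
    induction y using induction with
    | smul d y => simp [form_tmul_tmul, map_prod, inner_conj_symm]; ring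
    | add y y' hy hy' => simp only [map_add, LinearMap.add_apply, hy, hy']
  | add x x' hx hx' => simp only [map_add, LinearMap.add_apply, hx, hx']

theorem form_self_nonneg (x : AlgTensor H) : 0 ≤ RCLike.re (form H x x) := by
  obtain ⟨m, c, v, rfl⟩ := exists_sum x
  rw [form_sum]
  exact (RCLike.nonneg_iff.mp ((posSemidef_prod Finset.univ
    (fun i => Matrix.gram ℂ (fun k => v k i))
    fun i _ => Matrix.posSemidef_gram ℂ _).dotProduct_mulVec_nonneg c)).1

variable (H) in
/-- The inner product of the algebraic tensor product. -/
@[reducible]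
def innerCore : PreInnerProductSpace.Core ℂ (AlgTensor H) where
  inner x y := form H y x
  conj_inner_symm x y := form_conj_symm x y
  re_inner_nonneg x := form_self_nonneg x
  add_left x y z := by simp
  smul_left x y r := by simp

instance : SeminormedAddCommGroup (AlgTensor H) :=
  @InnerProductSpace.Core.toSeminormedAddCommGroup ℂ (AlgTensor H) _ _ _ (innerCore H)

instance : InnerProductSpace ℂ (AlgTensor H) := InnerProductSpace.ofCore (innerCore H)

theorem inner_tmul (x y : ∀ i, H i) : ⟪tmul x, tmul y⟫_ℂ = ∏ i, ⟪x i, y i⟫_ℂ :=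
  form_tmul_tmul x y

variable [DecidableEq ι]

theorem norm_siteₗ_le (i : ι) (T : H i →L[ℂ] H i) (x : AlgTensor H) :
    ‖siteₗ i T x‖ ≤ ‖T‖ * ‖x‖ := by
  have key : RCLike.re (form H (siteₗ i T x) (siteₗ i T x)) ≤
      ‖T‖ ^ 2 * RCLike.re (form H x x) := by
    obtain ⟨m, c, v, rfl⟩ := exists_sum x
    have hT : siteₗ i T (∑ k, c k • tmul (v k)) =
        ∑ k, c k • tmul (Function.update (v k) i (T (v k i))) := by
      simp [siteₗ_tmul]
    rw [hT, form_sum, form_sum]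
    have h1 := (Matrix.posSemidef_opNorm_smul_gram_sub_gram (𝕜 := ℂ) (fun k => v k i) T).hadamard
      (posSemidef_prod {i}ᶜ (fun j => Matrix.gram ℂ (fun k => v k j))
        fun j _ => Matrix.posSemidef_gram ℂ _)
    have h2 := (RCLike.nonneg_iff.mp (h1.dotProduct_mulVec_nonneg c)).1
    have h3 : Matrix.hadamard (‖T‖ ^ 2 • Matrix.gram ℂ (fun k => v k i) -
          Matrix.gram ℂ (T ∘ fun k => v k i))
        (Matrix.of fun k l => ∏ j ∈ {i}ᶜ, Matrix.gram ℂ (fun k => v k j) k l) =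
        ((‖T‖ ^ 2 : ℝ) : ℂ) • (Matrix.of fun k l => ∏ j, Matrix.gram ℂ (fun k => v k j) k l) -
        (Matrix.of fun k l => ∏ j,
          Matrix.gram ℂ (fun k => Function.update (v k) i (T (v k i)) j) k l) := by
      ext k l
      simp only [Matrix.hadamard_apply, Matrix.sub_apply, Matrix.smul_apply, Matrix.of_apply,
        Matrix.gram_apply, Function.comp_apply]
      rw [Fintype.prod_eq_mul_prod_compl i, Fintype.prod_eq_mul_prod_compl i]
      have : ∏ j ∈ {i}ᶜ, ⟪Function.update (v k) i (T (v k i)) j,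
            Function.update (v l) i (T (v l i)) j⟫_ℂ = ∏ j ∈ {i}ᶜ, ⟪v k j, v l j⟫_ℂ := by
        refine Finset.prod_congr rfl fun j hj => ?_
        have : j ≠ i := by simpa using hj
        simp [this]
      rw [this]
      simp only [Function.update_self, Complex.real_smul, smul_eq_mul]
      ring
    rw [h3, Matrix.sub_mulVec, Matrix.smul_mulVec, dotProduct_sub, dotProduct_smul, map_sub,
      smul_eq_mul] at h2
    refine le_of_sub_nonneg (h2.trans_eq (congrArg (fun r : ℝ => r - _) ?_))
    exact Complex.re_ofReal_mul _ _
  have e (y : AlgTensor H) : ‖y‖ ^ 2 = RCLike.re (form H y y) :=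
    InnerProductSpace.norm_sq_eq_re_inner (𝕜 := ℂ) y
  rw [← e, ← e, ← mul_pow] at key
  exact le_of_sq_le_sq key (by positivity)

/-- `siteₗ` as a bounded operator. -/
def site (i : ι) (T : H i →L[ℂ] H i) : AlgTensor H →L[ℂ] AlgTensor H :=
  (siteₗ i T).mkContinuous ‖T‖ (norm_siteₗ_le i T)

end AlgTensor

/-- The Hilbert space tensor product `⨂ i, H i`: the completion of the algebraic tensor product
with respect to the inner product `⟪⊗ xᵢ, ⊗ yᵢ⟫ = ∏ i, ⟪x i, y i⟫`. -/
abbrev HilbertTensor [Fintype ι] : Type _ := UniformSpace.Completion (AlgTensor H)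

namespace HilbertTensor

variable {H} [Fintype ι]

/-- The elementary tensor `x₁ ⊗ ⋯ ⊗ xₙ` in the Hilbert space tensor product. -/
def tmul (x : ∀ i, H i) : HilbertTensor H := (AlgTensor.tmul x : AlgTensor H)

theorem inner_tmul (x y : ∀ i, H i) : ⟪tmul x, tmul y⟫_ℂ = ∏ i, ⟪x i, y i⟫_ℂ := by
  rw [tmul, tmul, UniformSpace.Completion.inner_coe, AlgTensor.inner_tmul]

variable [DecidableEq ι]

/-- The bounded operator `I ⊗ ⋯ ⊗ I ⊗ T ⊗ I ⊗ ⋯ ⊗ I`, with `T` in position `i`, on the Hilbert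
space tensor product. -/
def site (i : ι) (T : H i →L[ℂ] H i) : HilbertTensor H →L[ℂ] HilbertTensor H :=
  (AlgTensor.site i T).completion

theorem site_tmul (i : ι) (T : H i →L[ℂ] H i) (x : ∀ j, H j) :
    site i T (tmul x) = tmul (Function.update x i (T (x i))) := by
  rw [site, tmul, ContinuousLinearMap.completion_apply_coe, tmul]
  exact congrArg _ (AlgTensor.siteₗ_tmul i T x)

end HilbertTensor

end TensorProduct

/-! ### The Koszul complex of a tuple of operators -/

namespace Koszul

variable {n : ℕ} {E : Type*} [NormedAddCommGroup E] [NormedSpace ℂ E]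

/-- The total space of the Koszul complex, `E ⊗ Λ(ℂⁿ)`: the function `ξ` stands for
`∑ S, ξ S ⊗ e_S`, where `e_S = e_{s₁} ∧ ⋯ ∧ e_{sₚ}` for `S = {s₁ < ⋯ < sₚ}`. -/
abbrev Total (n : ℕ) (E : Type*) : Type _ := Finset (Fin n) → E

/-- The boundary operator of the Koszul complex of `T = (T₁, …, Tₙ)`,
`ξ ⊗ e_{s₁} ∧ ⋯ ∧ e_{sₚ} ↦ ∑ k, (-1)^(k-1) T_{sₖ} ξ ⊗ e_{s₁} ∧ ⋯ (omit e_{sₖ}) ⋯ ∧ e_{sₚ}`.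
The coefficient of `e_S` in the image of `ξ` collects the terms in which `i ∉ S` was omitted from
`S ∪ {i}`; the position of `i` in `S ∪ {i}` is one more than the number of `j ∈ S` with `j < i`. -/
def boundary (T : Fin n → E →L[ℂ] E) : Total n E →ₗ[ℂ] Total n E where
  toFun ξ S := ∑ i ∈ Sᶜ, (-1 : ℂ) ^ (S.filter (· < i)).card • T i (ξ (insert i S))
  map_add' ξ η := by
    ext S
    simp [Finset.sum_add_distrib]
  map_smul' c ξ := by
    ext S
    simp only [Pi.smul_apply, map_smul, RingHom.id_apply, Finset.smul_sum]
    exact Finset.sum_congr rfl fun i _ => smul_comm _ _ _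

variable (n E) in
/-- The chains of degree `p`, `E ⊗ Λᵖ(ℂⁿ)`. -/
def chains (p : ℕ) : Submodule ℂ (Total n E) where
  carrier := {ξ | ∀ S : Finset (Fin n), S.card ≠ p → ξ S = 0}
  add_mem' hξ hη S hS := by simp [hξ S hS, hη S hS]
  zero_mem' _ _ := rfl
  smul_mem' c ξ hξ S hS := by simp [hξ S hS]

/-- The cycles of degree `p`. -/
def cycles (T : Fin n → E →L[ℂ] E) (p : ℕ) : Submodule ℂ (Total n E) :=
  chains n E p ⊓ (boundary T).ker

/-- The boundaries of degree `p`. -/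
def boundaries (T : Fin n → E →L[ℂ] E) (p : ℕ) : Submodule ℂ (Total n E) :=
  (chains n E (p + 1)).map (boundary T)

/-- The boundary operator squares to zero when the operators commute. -/
theorem boundary_boundary (T : Fin n → E →L[ℂ] E) (hT : ∀ i j, Commute (T i) (T j))
    (ξ : Total n E) : boundary T (boundary T ξ) = 0 := by
  ext S
  simp only [boundary, LinearMap.coe_mk, AddHom.coe_mk, map_sum, map_smul, Finset.smul_sum,
    Pi.zero_apply]
  rw [Finset.sum_sigma']
  have hcard (i j : Fin n) (hi : i ∉ S) :
      ((insert i S).filter (· < j)).card =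
        (S.filter (· < j)).card + if i < j then 1 else 0 := by
    rw [Finset.filter_insert]
    split_ifs with h
    · rw [Finset.card_insert_of_notMem (by simp [hi])]
    · rfl
  refine Finset.sum_involution (fun x _ => ⟨x.2, x.1⟩) ?_ ?_ ?_ ?_
  · rintro ⟨i, j⟩ h
    simp only [Finset.mem_sigma, Finset.mem_compl, Finset.mem_insert, not_or] at h
    obtain ⟨hi, hji, hj⟩ := h
    have hc : T j (T i (ξ (insert i (insert j S)))) = T i (T j (ξ (insert j (insert i S)))) := by
      rw [Finset.insert_comm]
      exact congrArg (fun A : E →L[ℂ] E => A _) (hT j i)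
    simp only [hc, smul_smul, ← add_smul, hcard i j hi, hcard j i hj]
    rcases lt_or_gt_of_ne hji with h | h
    · simp only [h, h.not_gt, if_true, if_false]
      rw [show ∀ a b : ℂ, a = -b → (a + b) • T i (T j (ξ (insert j (insert i S)))) = 0 from
        fun a b hab => by simp [hab]]
      ring
    · simp only [h, h.not_gt, if_true, if_false]
      rw [show ∀ a b : ℂ, a = -b → (a + b) • T i (T j (ξ (insert j (insert i S)))) = 0 from
        fun a b hab => by simp [hab]]
      ring
  · rintro ⟨i, j⟩ h _ heq
    simp only [Finset.mem_sigma, Finset.mem_compl, Finset.mem_insert, not_or] at h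
    exact h.2.1 (congrArg Sigma.fst heq)
  · rintro ⟨i, j⟩ h
    simp only [Finset.mem_sigma, Finset.mem_compl, Finset.mem_insert, not_or] at h ⊢
    exact ⟨h.2.2, fun e => h.2.1 e.symm, h.1⟩
  · rintro ⟨i, j⟩ _
    rfl

/-- The boundary operator lowers the degree by one. -/
theorem boundary_mem_chains (T : Fin n → E →L[ℂ] E) (p : ℕ) {ξ : Total n E}
    (hξ : ξ ∈ chains n E (p + 1)) : boundary T ξ ∈ chains n E p := by
  intro S hS
  refine Finset.sum_eq_zero fun i hi => ?_
  rw [hξ, map_zero, smul_zero]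
  rw [Finset.card_insert_of_notMem (by simpa using hi)]
  omega

theorem boundaries_le_cycles (T : Fin n → E →L[ℂ] E) (hT : ∀ i j, Commute (T i) (T j)) (p : ℕ) :
    boundaries T p ≤ cycles T p := by
  rintro _ ⟨ξ, hξ, rfl⟩
  exact ⟨boundary_mem_chains T p hξ, boundary_boundary T hT ξ⟩

/-- The `p`-th homology space of the Koszul complex, cycles modulo boundaries. -/
abbrev Homology (T : Fin n → E →L[ℂ] E) (p : ℕ) : Type _ :=
  cycles T p ⧸ (boundaries T p).submoduleOf (cycles T p)

/-- A tuple `T = (T₁, …, Tₙ)` of bounded operators is Fredholm if the operators commute and all the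
homology spaces of the Koszul complex are finite-dimensional. -/
def IsFredholm (T : Fin n → E →L[ℂ] E) : Prop :=
  (∀ i j, Commute (T i) (T j)) ∧ ∀ p ≤ n, FiniteDimensional ℂ (Homology T p)

/-- The index `∑ p, (-1)^(p+1) dim Homology T p` of a Fredholm tuple. For `n = 1` this is
`dim ker T₁ - dim coker T₁`. -/
def index (T : Fin n → E →L[ℂ] E) : ℤ :=
  ∑ p ∈ Finset.range (n + 1), (-1 : ℤ) ^ (p + 1) * (Module.finrank ℂ (Homology T p) : ℤ)

end Koszul

end

/-!
The Koszul complex of the operators `site i (T i)` is the tensor product of the two-term complexes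
`T i : H i → H i`, and the index formula is the Künneth formula for it.

Suppose that every `T i` is Fredholm. It has a bounded generalized inverse `G i`, with
`T i * G i * T i = T i`. Then `1 - G i * T i` projects onto the kernel of `T i`, and `1 - T i * G i`
projects onto a complement of its range. Contraction with `G j` in direction `j`
(`Koszul.homotopy`) is a homotopy between the identity of the Koszul complex and the projection
that is `1 - G j * T j` on the components `S ∋ j` and `1 - T j * G j` on the others. Using this in
all directions, every homology class has exactly one harmonic representative
(`Koszul.nonempty_harmonic_equiv_homology`), that is, one whose component at `S` lies in the tensor
product of the kernels of the `T i`, `i ∈ S`, and of copies of the cokernels of the `T i`, `i ∉ S`.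
This tensor product is finite-dimensional, and its dimension is the product of the dimensions of its
factors (`HilbertTensor.finrank_fixed`). The alternating sum over `S` is the expansion of a product,
which gives the index.

Conversely, let the tuple be Fredholm, and suppose that `T i₀` is not. Then `T i₀` or its adjoint
fails to be bounded below on the complement of every finite-dimensional subspace
(`ContinuousLinearMap.isFredholm_of_bounded_below`), and so has approximate null vectors forming
orthonormal systems of any size. For `i ≠ i₀` the operator `T i` or its adjoint has at least one
approximate null vector, as `T i` is not invertible. Let `S` be the set of the `i` at which it is
`T i` and not its adjoint. For the tensor products `x` of these vectors, the chains `x ⊗ e_S` are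
almost annihilated by the boundary operator and by its adjoint. But for a Fredholm tuple the range
of the boundary operator is closed and of finite codimension in its kernel, so in a large enough
orthonormal system of such `x` some combination is close to a boundary while being almost orthogonal
to all boundaries (`Koszul.not_isFredholm_of_orthonormal`).
-/

open scoped InnerProductSpace

/-! ### Harmonic representatives in the Koszul complex -/

namespace Koszul

variable {n : ℕ} {E : Type*} [NormedAddCommGroup E] [NormedSpace ℂ E]

theorem boundary_apply (T : Fin n → E →L[ℂ] E) (ξ : Total n E) (S : Finset (Fin n)) :
    boundary T ξ S = ∑ i ∈ Sᶜ, (-1 : ℂ) ^ (S.filter (· < i)).card • T i (ξ (insert i S)) :=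
  rfl

/-- The contraction in direction `j`, which inserts `e_j` and applies `G`: for a generalized
inverse `G` of `T j` it is a homotopy between the identity and a projection. -/
def homotopy (j : Fin n) (G : E →L[ℂ] E) (ξ : Total n E) : Total n E := fun S =>
  if j ∈ S then (-1 : ℂ) ^ (S.filter (· < j)).card • G (ξ (S.erase j)) else 0

theorem homotopy_mem_chains (j : Fin n) (G : E →L[ℂ] E) {p : ℕ} {ξ : Total n E}
    (hξ : ξ ∈ chains n E p) : homotopy j G ξ ∈ chains n E (p + 1) := by
  intro S hS
  by_cases hj : j ∈ S
  · have hc := Finset.card_erase_add_one hj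
    simp only [homotopy, hj, if_true]
    rw [hξ (S.erase j) (by omega), map_zero, smul_zero]
  · simp [homotopy, hj]

theorem card_filter_insert_lt {i j : Fin n} {S : Finset (Fin n)} (hi : i ∉ S) :
    ((insert i S).filter (· < j)).card = (S.filter (· < j)).card + if i < j then 1 else 0 := by
  rw [Finset.filter_insert]
  split_ifs with h
  · rw [Finset.card_insert_of_notMem (by simp [hi])]
  · rfl

theorem homotopy_insert {j : Fin n} {S : Finset (Fin n)} (hj : j ∉ S) (G : E →L[ℂ] E)
    (ξ : Total n E) :
    homotopy j G ξ (insert j S) = (-1 : ℂ) ^ (S.filter (· < j)).card • G (ξ S) := by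
  simp [homotopy, card_filter_insert_lt hj, Finset.erase_insert hj]

theorem boundary_homotopy_of_notMem (T : Fin n → E →L[ℂ] E) {j : Fin n} (G : E →L[ℂ] E)
    (ξ : Total n E) {S : Finset (Fin n)} (hj : j ∉ S) :
    boundary T (homotopy j G ξ) S + homotopy j G (boundary T ξ) S = T j (G (ξ S)) := by
  have h0 : homotopy j G (boundary T ξ) S = 0 := by simp [homotopy, hj]
  rw [h0, add_zero, boundary_apply, Finset.sum_eq_single_of_mem j (by simpa using hj)]
  · rw [homotopy_insert hj, map_smul, smul_smul, ← pow_add, ← two_mul, pow_mul]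
    simp
  · intro i _ hij
    have : j ∉ insert i S := by simp [hj, hij.symm]
    simp [homotopy, this]

theorem boundary_homotopy_of_mem (T : Fin n → E →L[ℂ] E) {j : Fin n} (G : E →L[ℂ] E)
    (hG : ∀ i, i ≠ j → Commute G (T i)) (ξ : Total n E) {S : Finset (Fin n)} (hj : j ∈ S) :
    boundary T (homotopy j G ξ) S + homotopy j G (boundary T ξ) S = G (T j (ξ S)) := by
  obtain ⟨R, hjR, rfl⟩ : ∃ R, j ∉ R ∧ S = insert j R :=
    ⟨S.erase j, by simp, (Finset.insert_erase hj).symm⟩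
  have hR : Rᶜ = insert j (insert j R)ᶜ := by
    ext i
    by_cases h : i = j
    · simp [h, hjR]
    · simp [h]
  rw [homotopy_insert hjR, boundary_apply, boundary_apply, hR,
    Finset.sum_insert (by simp), map_add, map_smul, smul_add, smul_smul, ← pow_add, ← two_mul,
    pow_mul, neg_one_sq, one_pow, one_smul, add_comm (G _), ← add_assoc, map_sum,
    Finset.smul_sum, ← Finset.sum_add_distrib]
  refine add_eq_right.2 (Finset.sum_eq_zero fun i hi => ?_)
  simp only [Finset.mem_compl, Finset.mem_insert, not_or] at hi
  have hc : G (T i (ξ (insert i R))) = T i (G (ξ (insert i R))) :=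
    congrArg (fun A : E →L[ℂ] E => A _) (hG i hi.1)
  have hj' : j ∉ insert i R := by simp [hjR, Ne.symm hi.1]
  rw [Finset.insert_comm, homotopy_insert hj', map_smul, map_smul, hc, smul_smul, smul_smul,
    ← add_smul, card_filter_insert_lt hi.2, card_filter_insert_lt hjR]
  rw [show ∀ a b : ℂ, a = -b → (a + b) • T i (G (ξ (insert i R))) = 0 from
    fun a b hab => by simp [hab]]
  rcases lt_or_gt_of_ne hi.1 with h | h
  · simp only [h, h.not_gt, if_true, if_false]
    ring
  · simp only [h, h.not_gt, if_true, if_false]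
    ring

/-- The vectors `x` for which `x ⊗ e_S` is harmonic, relative to generalized inverses `G i` of the
`T i`: they lie in the kernel of `T i` for `i ∈ S`, and in the complement `ker (T i * G i)` of the
range of `T i` for `i ∉ S`. -/
def harmonicAt (T G : Fin n → E →L[ℂ] E) (S : Finset (Fin n)) : Submodule ℂ E where
  carrier := {x | ∀ i, if i ∈ S then T i x = 0 else T i (G i x) = 0}
  add_mem' {x y} hx hy i := by
    have h1 := hx i
    have h2 := hy i
    split_ifs at h1 h2 ⊢ <;> simp [h1, h2]
  zero_mem' i := by simp
  smul_mem' c x hx i := by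
    have h1 := hx i
    split_ifs at h1 ⊢ <;> simp [h1]

theorem mem_harmonicAt {T G : Fin n → E →L[ℂ] E} {S : Finset (Fin n)} {x : E} :
    x ∈ harmonicAt T G S ↔ ∀ i, if i ∈ S then T i x = 0 else T i (G i x) = 0 :=
  Iff.rfl

/-- The complements `ker (T i * G i)` of the ranges of the `T i`, `i ∈ A`, intersect in a space that
meets the sum of these ranges trivially. -/
theorem eq_zero_of_eq_sum {T G : Fin n → E →L[ℂ] E}
    (hTG : ∀ i j, i ≠ j → Commute (T i) (G j)) (hTT : ∀ i j, Commute (T i) (T j))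
    (hTGT : ∀ i, T i * G i * T i = T i) (A : Finset (Fin n)) {x : E} (y : Fin n → E)
    (hx : ∀ i ∈ A, T i (G i x) = 0) (hxy : x = ∑ i ∈ A, T i (y i)) : x = 0 := by
  induction A using Finset.induction_on generalizing y with
  | empty => simpa using hxy
  | insert j A hj ih =>
    -- Apply the projection `1 - T j * G j`, which fixes `x` and kills the range of `T j`.
    refine ih (fun i => y i - T j (G j (y i))) (fun i hi => hx i (by simp [hi])) ?_
    have h1 : x = x - T j (G j x) := by rw [hx j (by simp), sub_zero]
    have h2 : T j (G j (T j (y j))) = T j (y j) :=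
      congrArg (fun B : E →L[ℂ] E => B (y j)) (hTGT j)
    rw [h1, hxy, Finset.sum_insert hj]
    simp only [map_add, map_sum, map_sub, Finset.sum_sub_distrib, h2]
    rw [add_sub_add_left_eq_sub]
    congr 1
    refine Finset.sum_congr rfl fun i hi => ?_
    have hij : i ≠ j := fun h => hj (h ▸ hi)
    have e1 : G j (T i (y i)) = T i (G j (y i)) :=
      congrArg (fun B : E →L[ℂ] E => B (y i)) (hTG i j hij).symm
    have e2 : T j (T i (G j (y i))) = T i (T j (G j (y i))) :=
      congrArg (fun B : E →L[ℂ] E => B (G j (y i))) (hTT j i)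
    rw [e1, e2]

/-- The harmonic chains of degree `p`. -/
def harmonic (T G : Fin n → E →L[ℂ] E) (p : ℕ) : Submodule ℂ (Total n E) :=
  chains n E p ⊓ Submodule.pi Set.univ (harmonicAt T G)

theorem mem_harmonic {T G : Fin n → E →L[ℂ] E} {p : ℕ} {ξ : Total n E} :
    ξ ∈ harmonic T G p ↔ ξ ∈ chains n E p ∧ ∀ S, ξ S ∈ harmonicAt T G S := by
  simp [harmonic, Submodule.mem_pi]

theorem harmonic_le_cycles (T G : Fin n → E →L[ℂ] E) (p : ℕ) :
    harmonic T G p ≤ cycles T p := by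
  intro ξ hξ
  obtain ⟨h1, h2⟩ := mem_harmonic.1 hξ
  refine ⟨h1, ?_⟩
  ext S
  refine Finset.sum_eq_zero fun i _ => ?_
  have := h2 (insert i S) i
  rw [if_pos (by simp)] at this
  rw [this, smul_zero]

section

variable {T G : Fin n → E →L[ℂ] E}
  (hTT : ∀ i j, Commute (T i) (T j)) (hGG : ∀ i j, Commute (G i) (G j))
  (hTG : ∀ i j, i ≠ j → Commute (T i) (G j)) (hTGT : ∀ i, T i * G i * T i = T i)
include hTT hTG hTGT

theorem disjoint_harmonic_boundaries (p : ℕ) : Disjoint (harmonic T G p) (boundaries T p) := by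
  rw [Submodule.disjoint_def]
  rintro _ hξ ⟨η, hη, rfl⟩
  ext S
  refine eq_zero_of_eq_sum hTG hTT hTGT Sᶜ
    (fun i => (-1 : ℂ) ^ (S.filter (· < i)).card • η (insert i S)) (fun i hi => ?_) ?_
  · have := (mem_harmonic.1 hξ).2 S i
    rwa [if_neg (by simpa using hi)] at this
  · simp [boundary_apply]

include hGG

/-- Every cycle is homologous to a cycle that is harmonic in the directions `i ∈ A`: the projection
in direction `j` is homotopic to the identity and commutes with those in the other directions. -/
theorem exists_partially_harmonic (p : ℕ) (A : Finset (Fin n)) {ξ : Total n E}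
    (hξ : ξ ∈ cycles T p) : ∃ ξ' ∈ cycles T p, ξ - ξ' ∈ boundaries T p ∧
      ∀ S, ∀ i ∈ A, if i ∈ S then T i (ξ' S) = 0 else T i (G i (ξ' S)) = 0 := by
  induction A using Finset.induction_on with
  | empty => exact ⟨ξ, hξ, by simp, by simp⟩
  | insert j A hj ih =>
    obtain ⟨ξ', h1, h2, h3⟩ := ih
    have hb : boundary T ξ' = 0 := h1.2
    have hB : boundary T (homotopy j (G j) ξ') ∈ boundaries T p :=
      ⟨_, homotopy_mem_chains j (G j) h1.1, rfl⟩
    have h0 (S) : homotopy j (G j) (boundary T ξ') S = 0 := by simp [hb, homotopy]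
    have hap (B C : E →L[ℂ] E) (h : Commute B C) (x : E) : B (C x) = C (B x) :=
      congrArg (fun B : E →L[ℂ] E => B x) h
    have hap3 (i) (x : E) : T i (G i (T i x)) = T i x :=
      congrArg (fun B : E →L[ℂ] E => B x) (hTGT i)
    refine ⟨ξ' - boundary T (homotopy j (G j) ξ'),
      sub_mem h1 (boundaries_le_cycles T hTT p hB), ?_, fun S i hi => ?_⟩
    · rw [sub_sub_eq_add_sub, add_sub_right_comm]
      exact add_mem h2 hB
    -- The value of the new cycle at `S` is `(1 - G j * T j) (ξ' S)` or `(1 - T j * G j) (ξ' S)`.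
    by_cases hjS : j ∈ S
    · have e := boundary_homotopy_of_mem T (G j) (fun i hi => (hTG i j hi).symm) ξ' hjS
      rw [h0, add_zero] at e
      rw [Pi.sub_apply, e]
      by_cases hij : i = j
      · subst hij
        simp [hjS, hap3]
      · have := h3 S i (Finset.mem_of_mem_insert_of_ne hi hij)
        split_ifs at this ⊢
        · rw [map_sub, hap _ _ (hTG i j hij), hap _ _ (hTT i j), this]
          simp
        · rw [map_sub, map_sub, hap _ _ (hGG i j), hap _ _ (hTG j i (Ne.symm hij)).symm,
            hap _ _ (hTG i j hij), hap _ _ (hTT i j), this]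
          simp
    · have e := boundary_homotopy_of_notMem T (G j) ξ' hjS
      rw [h0, add_zero] at e
      rw [Pi.sub_apply, e]
      by_cases hij : i = j
      · subst hij
        simp [hjS, hap3]
      · have := h3 S i (Finset.mem_of_mem_insert_of_ne hi hij)
        split_ifs at this ⊢
        · rw [map_sub, hap _ _ (hTT i j), hap _ _ (hTG i j hij), this]
          simp
        · rw [map_sub, map_sub, hap _ _ (hTG j i (Ne.symm hij)).symm, hap _ _ (hGG i j),
            hap _ _ (hTT i j), hap _ _ (hTG i j hij), this]
          simp

/-- Hodge decomposition: every homology class has exactly one harmonic representative. -/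
theorem nonempty_harmonic_equiv_homology (p : ℕ) :
    Nonempty (harmonic T G p ≃ₗ[ℂ] Homology T p) := by
  let f : harmonic T G p →ₗ[ℂ] Homology T p :=
    ((boundaries T p).submoduleOf (cycles T p)).mkQ ∘ₗ
      Submodule.inclusion (harmonic_le_cycles T G p)
  refine ⟨LinearEquiv.ofBijective f ⟨?_, ?_⟩⟩
  · rw [← LinearMap.ker_eq_bot, Submodule.eq_bot_iff]
    rintro ⟨ξ, hξ⟩ h
    have hb : ξ ∈ boundaries T p := by
      have h' := (Submodule.Quotient.mk_eq_zero _).1 h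
      exact h'
    exact Subtype.ext
      (Submodule.disjoint_def.1 (disjoint_harmonic_boundaries hTT hTG hTGT p) ξ hξ hb)
  · intro z
    obtain ⟨⟨ξ, hξ⟩, rfl⟩ := Submodule.mkQ_surjective _ z
    obtain ⟨ξ', h1, h2, h3⟩ := exists_partially_harmonic hTT hGG hTG hTGT p Finset.univ hξ
    refine ⟨⟨ξ', mem_harmonic.2 ⟨h1.1, fun S i => h3 S i (Finset.mem_univ i)⟩⟩, ?_⟩
    refine (Submodule.Quotient.eq _).2 ?_
    rw [← neg_mem_iff, neg_sub]
    exact h2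

omit hTT hGG hTG hTGT in
/-- A harmonic chain of degree `p` is a family of harmonic vectors, one for each set of size `p`. -/
def harmonicEquiv (T G : Fin n → E →L[ℂ] E) (p : ℕ) :
    harmonic T G p ≃ₗ[ℂ] ∀ S : Finset.powersetCard p (Finset.univ : Finset (Fin n)),
      harmonicAt T G S where
  toFun ξ S := ⟨ξ.1 S, (mem_harmonic.1 ξ.2).2 S⟩
  map_add' _ _ := rfl
  map_smul' _ _ := rfl
  invFun ξ := ⟨fun S => if h : S.card = p then
      ξ ⟨S, Finset.mem_powersetCard.2 ⟨Finset.subset_univ S, h⟩⟩ else 0, by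
    refine mem_harmonic.2 ⟨fun S hS => by simp [hS], fun S => ?_⟩
    split_ifs with h
    · exact (ξ ⟨S, Finset.mem_powersetCard.2 ⟨Finset.subset_univ S, h⟩⟩).2
    · exact zero_mem _⟩
  left_inv ξ := by
    ext S
    by_cases h : S.card = p
    · simp [h]
    · simp [h, ξ.2.1 S h]
  right_inv ξ := by
    ext S
    have := (Finset.mem_powersetCard.1 S.2).2
    simp [this]

theorem finiteDimensional_homology [∀ S, FiniteDimensional ℂ (harmonicAt T G S)] (p : ℕ) :
    FiniteDimensional ℂ (Homology T p) := by
  obtain ⟨e⟩ := nonempty_harmonic_equiv_homology hTT hGG hTG hTGT p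
  exact ((harmonicEquiv T G p).symm.trans e).finiteDimensional

theorem finrank_homology [∀ S, FiniteDimensional ℂ (harmonicAt T G S)] (p : ℕ) :
    Module.finrank ℂ (Homology T p) = ∑ S ∈ Finset.powersetCard p (Finset.univ : Finset (Fin n)),
      Module.finrank ℂ (harmonicAt T G S) := by
  obtain ⟨e⟩ := nonempty_harmonic_equiv_homology hTT hGG hTG hTGT p
  rw [← ((harmonicEquiv T G p).symm.trans e).finrank_eq, Module.finrank_pi_fintype,
    Finset.sum_coe_sort _ fun S => Module.finrank ℂ (harmonicAt T G S)]

theorem index_eq_sum [∀ S, FiniteDimensional ℂ (harmonicAt T G S)] :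
    index T = ∑ S : Finset (Fin n),
      (-1 : ℤ) ^ (S.card + 1) * Module.finrank ℂ (harmonicAt T G S) := by
  rw [index, ← Finset.powerset_univ, Finset.sum_powerset, Finset.card_univ, Fintype.card_fin]
  refine Finset.sum_congr rfl fun p _ => ?_
  rw [finrank_homology hTT hGG hTG hTGT, Nat.cast_sum, Finset.mul_sum]
  refine Finset.sum_congr rfl fun S hS => ?_
  rw [(Finset.mem_powersetCard.1 hS).2]

end

end Koszul

/-! ### Operators on the Hilbert space tensor product -/

namespace HilbertTensor

variable {ι : Type*} {H : ι → Type*}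
  [∀ i, NormedAddCommGroup (H i)] [∀ i, InnerProductSpace ℂ (H i)] [Fintype ι]

/-- The elementary tensor `x₁ ⊗ ⋯ ⊗ xₙ` as a multilinear map in `x`. -/
noncomputable def tmulMulti : MultilinearMap ℂ H (HilbertTensor H) :=
  (UniformSpace.Completion.toComplL (𝕜 := ℂ) (E := AlgTensor H)).toLinearMap.compMultilinearMap
    (PiTensorProduct.tprod ℂ : MultilinearMap ℂ H (AlgTensor H))

theorem tmulMulti_apply (x : ∀ i, H i) : tmulMulti x = tmul x := rfl

theorem clm_ext {F : Type*} [NormedAddCommGroup F] [NormedSpace ℂ F]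
    {A B : HilbertTensor H →L[ℂ] F} (h : ∀ x, A (tmul x) = B (tmul x)) : A = B := by
  ext z
  induction z using UniformSpace.Completion.induction_on with
  | hp => exact isClosed_eq A.continuous B.continuous
  | ih z =>
    induction z using AlgTensor.induction with
    | smul c x =>
      rw [UniformSpace.Completion.coe_smul, map_smul, map_smul]
      exact congrArg _ (h x)
    | add x y hx hy => rw [UniformSpace.Completion.coe_add, map_add, map_add, hx, hy]

/-- An operator that maps the elementary tensors into a closed subspace has its range there. -/
theorem apply_mem {F : Type*} [NormedAddCommGroup F] [NormedSpace ℂ F]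
    {A : HilbertTensor H →L[ℂ] F} {W : Submodule ℂ F} (hW : IsClosed (W : Set F))
    (h : ∀ x, A (tmul x) ∈ W) (z : HilbertTensor H) : A z ∈ W := by
  induction z using UniformSpace.Completion.induction_on with
  | hp => exact hW.preimage A.continuous
  | ih z =>
    induction z using AlgTensor.induction with
    | smul c x =>
      rw [UniformSpace.Completion.coe_smul, map_smul]
      exact W.smul_mem c (h x)
    | add x y hx hy =>
      rw [UniformSpace.Completion.coe_add, map_add]
      exact W.add_mem hx hy

theorem norm_tmul (x : ∀ i, H i) : ‖tmul x‖ = ∏ i, ‖x i‖ := by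
  have h : ((‖tmul x‖ : ℂ)) ^ 2 = (∏ i, (‖x i‖ : ℂ)) ^ 2 := by
    rw [← Finset.prod_pow]
    refine (inner_self_eq_norm_sq_to_K (𝕜 := ℂ) (tmul x)).symm.trans ((inner_tmul x x).trans ?_)
    exact Finset.prod_congr rfl fun i _ => inner_self_eq_norm_sq_to_K _
  have h' : ‖tmul x‖ ^ 2 = (∏ i, ‖x i‖) ^ 2 := by exact_mod_cast h
  exact (pow_left_inj₀ (norm_nonneg _) (Finset.prod_nonneg fun i _ => norm_nonneg _)
    two_ne_zero).1 h'

variable [DecidableEq ι]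

theorem site_mul (i : ι) (A B : H i →L[ℂ] H i) : site i (A * B) = site i A * site i B :=
  clm_ext fun x => by simp [site_tmul]

theorem site_one (i : ι) : site i (1 : H i →L[ℂ] H i) = 1 :=
  clm_ext fun x => by simp [site_tmul]

theorem site_sub (i : ι) (A B : H i →L[ℂ] H i) : site i (A - B) = site i A - site i B :=
  clm_ext fun x => by
    simp only [sub_apply, site_tmul]
    simp only [← tmulMulti_apply, MultilinearMap.map_update_sub]

theorem commute_site {i j : ι} (hij : i ≠ j) (A : H i →L[ℂ] H i) (B : H j →L[ℂ] H j) :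
    Commute (site i A) (site j B) :=
  clm_ext fun x => by
    simp [site_tmul, hij, hij.symm, Function.update_comm hij]

theorem adjoint_site [∀ i, CompleteSpace (H i)] (i : ι) (A : H i →L[ℂ] H i) :
    ContinuousLinearMap.adjoint (site i A) = site i (ContinuousLinearMap.adjoint A) := by
  symm
  rw [ContinuousLinearMap.eq_adjoint_iff]
  intro x y
  have key (v w : ∀ i, H i) :
      ⟪site i (ContinuousLinearMap.adjoint A) (tmul v), tmul w⟫_ℂ =
        ⟪tmul v, site i A (tmul w)⟫_ℂ := by
    simp only [site_tmul, inner_tmul]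
    refine Finset.prod_congr rfl fun j _ => ?_
    by_cases h : j = i
    · subst h
      simp [ContinuousLinearMap.adjoint_inner_left]
    · simp [h]
  have h1 (v : ∀ i, H i) : innerSL ℂ (site i (ContinuousLinearMap.adjoint A) (tmul v)) =
      innerSL ℂ (tmul v) ∘L site i A := clm_ext fun w => by simpa using key v w
  have h2 : innerSL ℂ y ∘L site i (ContinuousLinearMap.adjoint A) =
      innerSL ℂ (site i A y) := clm_ext fun v => by
    have := congrArg (starRingEnd ℂ) (congrArg (fun f => f y) (h1 v))
    simpa [inner_conj_symm] using this
  have := congrArg (starRingEnd ℂ) (congrArg (fun f => f x) h2)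
  simpa [inner_conj_symm] using this

/-- The operator `⨂ p i`, described by its two properties that matter here. -/
theorem exists_map (p : ∀ i, H i →L[ℂ] H i) :
    ∃ R : HilbertTensor H →L[ℂ] HilbertTensor H, (∀ x, R (tmul x) = tmul fun i => p i (x i)) ∧
      ∀ z, (∀ i, site i (p i) z = z) → R z = z := by
  suffices h : ∀ A : Finset ι, ∃ R : HilbertTensor H →L[ℂ] HilbertTensor H,
      (∀ x, R (tmul x) = tmul fun i => if i ∈ A then p i (x i) else x i) ∧
      ∀ z, (∀ i, site i (p i) z = z) → R z = z by
    simpa using h Finset.univ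
  intro A
  induction A using Finset.induction_on with
  | empty => exact ⟨1, by simp, by simp⟩
  | insert j A hj ih =>
    obtain ⟨R, h1, h2⟩ := ih
    refine ⟨site j (p j) * R, fun x => ?_, fun z hz => ?_⟩
    · rw [mul_apply_eq_comp, h1, site_tmul]
      congr 1
      funext i
      by_cases h : i = j
      · subst h
        simp [hj]
      · simp [h]
    · rw [mul_apply_eq_comp, h2 z hz, hz j]

omit [DecidableEq ι] in
/-- Elementary tensors of orthonormal systems form an orthonormal system. -/
theorem orthonormal_tmul {κ : ι → Type*} {b : ∀ i, κ i → H i}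
    (hb : ∀ i, Orthonormal ℂ (b i)) :
    Orthonormal ℂ fun f : ∀ i, κ i => tmul fun i => b i (f i) := by
  classical
  rw [orthonormal_iff_ite]
  intro f g
  simp_rw [inner_tmul, fun i => orthonormal_iff_ite.1 (hb i)]
  rw [Finset.prod_ite_zero]
  simp [funext_iff]

/-- The common fixed space of the operators `site i (p i)`; for idempotents `p i` of finite rank it
is the tensor product of their ranges. -/
noncomputable def fixed (p : ∀ i, H i →L[ℂ] H i) : Submodule ℂ (HilbertTensor H) :=
  ⨅ i, (site i (p i) - 1).ker

theorem mem_fixed {p : ∀ i, H i →L[ℂ] H i} {z : HilbertTensor H} :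
    z ∈ fixed p ↔ ∀ i, site i (p i) z = z := by
  simp [fixed, Submodule.mem_iInf, sub_eq_zero]

/-- On the fixed space the operator `⨂ p i` is the identity, and it maps every elementary tensor,
hence the whole space, into the span on the right, which is finite-dimensional and so closed. -/
theorem fixed_eq_span (p : ∀ i, H i →L[ℂ] H i) (hp : ∀ i, IsIdempotentElem (p i))
    {κ : ι → Type*} [∀ i, Fintype (κ i)]
    (b : ∀ i, κ i → H i) (hb : ∀ i, Submodule.span ℂ (Set.range (b i)) = (p i).range) :
    fixed p = Submodule.span ℂ (Set.range fun f : ∀ i, κ i => tmul fun i => b i (f i)) := by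
  classical
  apply le_antisymm
  · intro z hz
    obtain ⟨R, h1, h2⟩ := exists_map p
    rw [← h2 z (mem_fixed.1 hz)]
    have := FiniteDimensional.span_of_finite ℂ
      (Set.finite_range fun f : ∀ i, κ i => tmul fun i => b i (f i))
    refine apply_mem (Submodule.closed_of_finiteDimensional _) (fun x => ?_) z
    rw [h1]
    have hc (i) : ∃ c : κ i → ℂ, ∑ k, c k • b i k = p i (x i) := by
      rw [← Submodule.mem_span_range_iff_exists_fun, hb]
      exact ⟨x i, rfl⟩
    choose c hc using hc
    rw [← tmulMulti_apply, ← funext hc, MultilinearMap.map_sum]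
    refine Submodule.sum_mem _ fun f _ => ?_
    rw [MultilinearMap.map_smul_univ]
    exact Submodule.smul_mem _ _ (Submodule.subset_span ⟨f, rfl⟩)
  · rw [Submodule.span_le]
    rintro _ ⟨f, rfl⟩
    refine mem_fixed.2 fun i => ?_
    have hm : b i (f i) ∈ (p i).range := hb i ▸ Submodule.subset_span ⟨f i, rfl⟩
    obtain ⟨y, hy⟩ := hm
    have hy' : p i (b i (f i)) = b i (f i) := by
      rw [← hy]
      exact congrArg (fun A : H i →L[ℂ] H i => A y) (hp i)
    rw [site_tmul, hy', Function.update_eq_self]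

theorem finrank_fixed (p : ∀ i, H i →L[ℂ] H i) (hp : ∀ i, IsIdempotentElem (p i))
    [∀ i, FiniteDimensional ℂ (p i).range] :
    FiniteDimensional ℂ (fixed p) ∧
      Module.finrank ℂ (fixed p) = ∏ i, Module.finrank ℂ (p i).range := by
  let b (i) (k : Fin (Module.finrank ℂ (p i).range)) : H i :=
    stdOrthonormalBasis ℂ (p i).range k
  have ho (i) : Orthonormal ℂ (b i) :=
    (stdOrthonormalBasis ℂ (p i).range).orthonormal.comp_linearIsometry
      (p i).range.subtypeₗᵢ
  have hs (i) : Submodule.span ℂ (Set.range (b i)) = (p i).range := by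
    have h := (stdOrthonormalBasis ℂ (p i).range).toBasis.span_eq
    have h' := congrArg (Submodule.map (p i).range.subtype) h
    rw [Submodule.map_span, ← Set.range_comp, Submodule.map_top, Submodule.range_subtype] at h'
    refine Eq.trans ?_ h'
    congr 2
  rw [fixed_eq_span p hp b hs]
  refine ⟨FiniteDimensional.span_of_finite ℂ (Set.finite_range _), ?_⟩
  rw [finrank_span_eq_card (orthonormal_tmul ho).linearIndependent]
  simp

end HilbertTensor

/-! ### Fredholm operators on Hilbert spaces -/

namespace ContinuousLinearMap

variable {E : Type*} [NormedAddCommGroup E] [InnerProductSpace ℂ E]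

/-- A Fredholm operator has a bounded generalized inverse. -/
theorem IsFredholm.exists_mul_mul_eq {T : E →L[ℂ] E} (hT : T.IsFredholm) :
    ∃ G : E →L[ℂ] E, T * G * T = T := by
  obtain ⟨pkg⟩ := hT.nonempty_fredholmPackage
  refine ⟨pkg.quasiInverse, ?_⟩
  ext x
  have h (y : E) : T y = pkg.equiv (pkg.decDom.proj y) := by
    conv_lhs => rw [pkg.eq_equiv]
    rfl
  have h' : pkg.decCodom.proj (T x) = pkg.equiv (pkg.decDom.proj x) := by
    rw [h]
    simp
  change T (pkg.decDom.X₁.subtypeL (pkg.equiv.symm (pkg.decCodom.proj (T x)))) = T x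
  rw [h', h, h]
  generalize pkg.decDom.proj x = w
  simp

section GeneralizedInverse

variable {T G : E →L[ℂ] E} (h : T * G * T = T)
include h

theorem isIdempotentElem_one_sub_mul_left : IsIdempotentElem (1 - G * T) := by
  have : G * T * (G * T) = G * T := by rw [mul_assoc, ← mul_assoc T, h]
  rw [IsIdempotentElem, sub_mul, one_mul, mul_sub, mul_one, this, sub_self, sub_zero]

theorem isIdempotentElem_one_sub_mul_right : IsIdempotentElem (1 - T * G) := by
  have : T * G * (T * G) = T * G := by rw [← mul_assoc, h]
  rw [IsIdempotentElem, sub_mul, one_mul, mul_sub, mul_one, this, sub_self, sub_zero]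

theorem range_one_sub_mul_left : (1 - G * T).range = T.ker := by
  apply le_antisymm
  · rintro _ ⟨x, rfl⟩
    have : T (G (T x)) = T x := congrArg (fun A : E →L[ℂ] E => A x) h
    simp [this]
  · intro x hx
    have : T x = 0 := hx
    exact ⟨x, by simp [this]⟩

theorem ker_one_sub_mul_right : (1 - T * G).ker = T.range := by
  apply le_antisymm
  · intro x hx
    have : x - T (G x) = 0 := by simpa using hx
    exact ⟨G x, (sub_eq_zero.1 this).symm⟩
  · rintro _ ⟨x, rfl⟩
    have : T (G (T x)) = T x := congrArg (fun A : E →L[ℂ] E => A x) h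
    simp [this]

/-- The range of the projection `1 - T * G` is a complement of the range of `T`. -/
theorem nonempty_quotient_range_equiv : Nonempty ((E ⧸ T.range) ≃ₗ[ℂ] (1 - T * G).range) :=
  ⟨(Submodule.quotEquivOfEq _ _ (ker_one_sub_mul_right h).symm).trans
    (LinearMap.quotKerEquivRange _)⟩

end GeneralizedInverse

/-- `T` is not bounded below: it has approximate null vectors. -/
def IsNotBoundedBelow (T : E →L[ℂ] E) : Prop :=
  ∀ ε : ℝ, 0 < ε → ∃ x, ‖x‖ = 1 ∧ ‖T x‖ ≤ ε

/-- `T` is not bounded below on the orthogonal complement of any finite-dimensional subspace. -/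
def IsEssentiallyNotBoundedBelow (T : E →L[ℂ] E) : Prop :=
  ∀ V : Submodule ℂ E, FiniteDimensional ℂ V → ∀ ε : ℝ, 0 < ε →
    ∃ x ∈ Vᗮ, ‖x‖ = 1 ∧ ‖T x‖ ≤ ε

theorem IsEssentiallyNotBoundedBelow.isNotBoundedBelow {T : E →L[ℂ] E}
    (hT : T.IsEssentiallyNotBoundedBelow) : T.IsNotBoundedBelow := fun ε hε =>
  let ⟨x, _, h⟩ := hT ⊥ inferInstance ε hε
  ⟨x, h⟩

theorem IsEssentiallyNotBoundedBelow.exists_orthonormal {T : E →L[ℂ] E}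
    (hT : T.IsEssentiallyNotBoundedBelow) {ε : ℝ} (hε : 0 < ε) (N : ℕ) :
    ∃ v : Fin N → E, Orthonormal ℂ v ∧ ∀ k, ‖T (v k)‖ ≤ ε := by
  induction N with
  | zero => exact ⟨Fin.elim0, ⟨fun k => k.elim0, Subsingleton.pairwise⟩, fun k => k.elim0⟩
  | succ N ih =>
    obtain ⟨v, hv, hTv⟩ := ih
    obtain ⟨x, hx, hx1, hTx⟩ := hT (Submodule.span ℂ (Set.range v))
      (FiniteDimensional.span_of_finite ℂ (Set.finite_range v)) ε hε
    have hvx (k) : ⟪v k, x⟫_ℂ = 0 :=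
      Submodule.inner_right_of_mem_orthogonal (Submodule.subset_span (Set.mem_range_self k)) hx
    have hxv (k) : ⟪x, v k⟫_ℂ = 0 := inner_eq_zero_symm.1 (hvx k)
    refine ⟨Fin.cons x v, ?_, Fin.cases (by simpa using hTx) (by simpa using hTv)⟩
    rw [orthonormal_iff_ite] at hv ⊢
    intro i j
    induction i using Fin.cases with
    | zero =>
      induction j using Fin.cases with
      | zero => simp [hx1]
      | succ j => simp [hxv, (Fin.succ_ne_zero j).symm]
    | succ i =>
      induction j using Fin.cases with
      | zero => simp [hvx]
      | succ j => simp [hv]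

theorem mul_norm_le_of_lt_norm {T : E →L[ℂ] E} {V : Submodule ℂ E} {ε : ℝ}
    (h : ∀ x ∈ Vᗮ, ‖x‖ = 1 → ε < ‖T x‖) : ∀ x ∈ Vᗮ, ε * ‖x‖ ≤ ‖T x‖ := by
  intro x hx
  by_cases h0 : x = 0
  · simp [h0]
  have hn : 0 < ‖x‖ := norm_pos_iff.2 h0
  have := h (((‖x‖⁻¹ : ℝ) : ℂ) • x) (Submodule.smul_mem _ _ hx) (by
    rw [norm_smul]
    simp [hn.ne'])
  rw [map_smul, norm_smul] at this
  simp only [Complex.ofReal_inv, norm_inv, Complex.norm_real, norm_norm] at this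
  rw [inv_mul_eq_div, lt_div_iff₀ hn] at this
  exact this.le

variable [CompleteSpace E]

/-- If `T` is bounded below on `Vᗮ` with `V` finite-dimensional, then `T(Vᗮ)` is closed, and its
orthogonal complement is the preimage of `V` under the adjoint of `T`, which is finite-dimensional
as soon as the kernel of the adjoint is. -/
theorem isFredholm_of_bounded_below {T : E →L[ℂ] E} (h1 : ¬ T.IsEssentiallyNotBoundedBelow)
    (h2 : ¬ (adjoint T).IsEssentiallyNotBoundedBelow) : T.IsFredholm := by
  simp only [IsEssentiallyNotBoundedBelow, not_forall, not_exists, not_and, not_le] at h1 h2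
  obtain ⟨V, hV, ε, hε, h1⟩ := h1
  obtain ⟨W, hW, δ, hδ, h2⟩ := h2
  replace h1 := mul_norm_le_of_lt_norm h1
  replace h2 := mul_norm_le_of_lt_norm h2
  have hcoV : Vᗮ.CoFG :=
    Submodule.FG.cofg_of_isCompl V.isCompl_orthogonal (V.fg_iff_finiteDimensional.2 hV)
  have hcoW : Wᗮ.CoFG :=
    Submodule.FG.cofg_of_isCompl W.isCompl_orthogonal (W.fg_iff_finiteDimensional.2 hW)
  have hker : (adjoint T).ker.FG := by
    refine hcoW.fg_of_disjoint (Submodule.disjoint_def.2 fun x hx hxW => ?_)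
    have h := h2 x hxW
    have hx0 : adjoint T x = 0 := hx
    rw [hx0, norm_zero] at h
    exact norm_le_zero_iff.1 (nonpos_of_mul_nonpos_right h hδ)
  -- `T` restricts to an isomorphism from `Vᗮ` onto `F = T(Vᗮ)`.
  let f : Vᗮ →L[ℂ] E := T ∘L Vᗮ.subtypeL
  have hf : AntilipschitzWith (Real.toNNReal ε⁻¹) f := by
    refine f.antilipschitz_of_bound fun x => ?_
    rw [Real.coe_toNNReal _ (inv_nonneg.2 hε.le), ← div_eq_inv_mul, le_div_iff₀ hε, mul_comm]
    exact h1 x x.2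
  have hclosed : IsClosed (f.range : Set E) := hf.isClosed_range f.uniformContinuous
  have hFperp : f.rangeᗮ = V.comap (adjoint T : E →ₗ[ℂ] E) := by
    ext y
    have hV' : adjoint T y ∈ V ↔ ∀ x ∈ Vᗮ, ⟪x, adjoint T y⟫_ℂ = 0 := by
      rw [← Submodule.mem_orthogonal, Submodule.orthogonal_orthogonal]
    refine Iff.trans ?_ hV'.symm
    rw [Submodule.mem_orthogonal]
    constructor
    · intro h x hx
      simpa [adjoint_inner_right] using h (T x) ⟨⟨x, hx⟩, rfl⟩
    · rintro h _ ⟨x, rfl⟩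
      simpa [adjoint_inner_right, f] using h x x.2
  have hFfg : f.rangeᗮ.FG := by
    rw [hFperp]
    refine Submodule.fg_of_fg_map_of_fg_inf_ker (adjoint T : E →ₗ[ℂ] E) ?_ ?_
    · exact Submodule.FG.of_le (V.fg_iff_finiteDimensional.2 hV)
        (Submodule.map_comap_le _ _)
    · exact Submodule.FG.of_le hker inf_le_right
  have : CompleteSpace f.range := hclosed.completeSpace_coe
  have hcoF : f.range.CoFG :=
    Submodule.FG.cofg_of_isCompl f.range.isCompl_orthogonal.symm hFfg
  refine IsFredholm.of_isInvertible_restrict (E₁ := Vᗮ) (F₁ := f.range)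
    V.isClosed_orthogonal hclosed (fun x hx => ⟨⟨x, hx⟩, rfl⟩) ?_
  exact ⟨f.equivRange hf.injective hclosed, by ext; rfl⟩

theorem isUnit_of_bounded_below {T : E →L[ℂ] E} (h1 : ¬ T.IsNotBoundedBelow)
    (h2 : ¬ (adjoint T).IsNotBoundedBelow) : IsUnit T := by
  simp only [IsNotBoundedBelow, not_forall, not_exists, not_and, not_le] at h1 h2
  obtain ⟨ε, hε, h1⟩ := h1
  obtain ⟨δ, hδ, h2⟩ := h2
  replace h1 := mul_norm_le_of_lt_norm (V := ⊥) fun x _ => h1 x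
  replace h2 := mul_norm_le_of_lt_norm (V := ⊥) fun x _ => h2 x
  have hT : AntilipschitzWith (Real.toNNReal ε⁻¹) T := by
    refine T.antilipschitz_of_bound fun x => ?_
    rw [Real.coe_toNNReal _ (inv_nonneg.2 hε.le), ← div_eq_inv_mul, le_div_iff₀ hε, mul_comm]
    exact h1 x (by simp)
  have hclosed : IsClosed (T.range : Set E) := hT.isClosed_range T.uniformContinuous
  have : CompleteSpace T.range := hclosed.completeSpace_coe
  have hr : T.range = ⊤ := by
    rw [← Submodule.orthogonal_eq_bot_iff, orthogonal_range, Submodule.eq_bot_iff]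
    intro x hx
    have hx0 : adjoint T x = 0 := hx
    have h := h2 x (by simp)
    rw [hx0, norm_zero] at h
    exact norm_le_zero_iff.1 (nonpos_of_mul_nonpos_right h hδ)
  exact isUnit_iff_bijective.2 ⟨hT.injective, LinearMap.range_eq_top.1 hr⟩

end ContinuousLinearMap

/-! ### Approximate null vectors of the Koszul complex -/

/-- A bounded operator onto a subspace of finite codimension in a complete subspace `Z` satisfies
the estimate of the open mapping theorem. -/
theorem ContinuousLinearMap.exists_preimage_norm_le_of_finite {X Y : Type*}
    [NormedAddCommGroup X] [NormedSpace ℂ X] [CompleteSpace X] [NormedAddCommGroup Y]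
    [NormedSpace ℂ Y] (f : X →L[ℂ] Y) (Z F : Submodule ℂ Y) [CompleteSpace Z]
    [FiniteDimensional ℂ F] (hf : f.range ≤ Z) (hZ : Z ≤ f.range ⊔ F) :
    ∃ C > 0, ∀ x, ∃ x', f x' = f x ∧ ‖x'‖ ≤ C * ‖f x‖ := by
  -- Replace `F` by a complement of the range in `Z`.
  obtain ⟨F', hF'⟩ := (f.range ⊓ (F ⊓ Z)).exists_isCompl
  set K := F ⊓ Z ⊓ F' with hK
  have hKF : K ≤ F := inf_le_left.trans inf_le_left
  have hKZ : K ≤ Z := inf_le_left.trans inf_le_right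
  have : FiniteDimensional ℂ K := Submodule.finiteDimensional_of_le hKF
  have hdisj : Disjoint f.range K := by
    rw [Submodule.disjoint_def]
    intro y hy hyK
    exact Submodule.disjoint_def.1 hF'.disjoint y ⟨hy, hyK.1⟩ hyK.2
  have hsup : Z ≤ f.range ⊔ K := by
    intro z hz
    obtain ⟨a, ha, b, hb, rfl⟩ := Submodule.mem_sup.1 (hZ hz)
    have hbZ : b ∈ Z := (Submodule.add_mem_iff_right Z (hf ha)).1 hz
    obtain ⟨c, hc, d, hd, rfl⟩ := Submodule.mem_sup.1
      (hF'.sup_eq_top ▸ Submodule.mem_top : b ∈ f.range ⊓ (F ⊓ Z) ⊔ F')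
    refine Submodule.mem_sup.2 ⟨a + c, add_mem ha hc.1, d, ⟨⟨?_, ?_⟩, hd⟩, by rw [add_assoc]⟩
    · exact (Submodule.add_mem_iff_right F hc.2.1).1 hb
    · exact (Submodule.add_mem_iff_right Z hc.2.2).1 hbZ
  let g : X × K →L[ℂ] Z :=
    (f.codRestrict Z fun x => hf ⟨x, rfl⟩).coprod (K.subtypeL.codRestrict Z fun x => hKZ x.2)
  have hg : Function.Surjective g := by
    rintro ⟨z, hz⟩
    obtain ⟨_, ⟨x, rfl⟩, b, hb, rfl⟩ := Submodule.mem_sup.1 (hsup hz)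
    exact ⟨(x, ⟨b, hb⟩), by ext; simp [g]⟩
  obtain ⟨C, hC, h⟩ := g.exists_preimage_norm_le hg
  refine ⟨C, hC, fun x => ?_⟩
  obtain ⟨⟨x', k⟩, h1, h2⟩ := h ⟨f x, hf ⟨x, rfl⟩⟩
  have h3 : f x' + k = f x := by simpa [g] using congrArg Subtype.val h1
  have hk : (k : Y) = 0 := by
    refine Submodule.disjoint_def.1 hdisj k ⟨x - x', ?_⟩ k.2
    simp [← h3]
  exact ⟨x', by simpa [hk] using h3, (le_max_left ‖x'‖ ‖k‖).trans h2⟩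

namespace Koszul

section

variable {n : ℕ} {E : Type*} [NormedAddCommGroup E] [NormedSpace ℂ E]

theorem mem_of_forall_component_mem {W : Submodule ℂ (Total n E)} {ξ : Total n E}
    (h : ∀ p, (fun S => if S.card = p then ξ S else 0) ∈ W) : ξ ∈ W := by
  have e : ξ = ∑ p ∈ Finset.range (n + 1), fun S => if S.card = p then ξ S else 0 := by
    ext S
    have hS : S.card < n + 1 := Nat.lt_succ_of_le (by simpa using S.card_le_univ)
    simp [Finset.sum_apply, hS]
  rw [e]
  exact Submodule.sum_mem _ fun p _ => h p

/-- The homogeneous components of a cycle are cycles. -/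
theorem component_mem_cycles {T : Fin n → E →L[ℂ] E} {ξ : Total n E} (hξ : boundary T ξ = 0)
    (p : ℕ) : (fun S => if S.card = p then ξ S else 0) ∈ cycles T p := by
  refine ⟨fun S hS => by simp [hS], ?_⟩
  ext S
  have h : boundary T (fun S => if S.card = p then ξ S else 0) S =
      if S.card + 1 = p then boundary T ξ S else 0 := by
    simp only [boundary_apply]
    split_ifs with hp
    · refine Finset.sum_congr rfl fun i hi => ?_
      rw [if_pos (by rw [Finset.card_insert_of_notMem (by simpa using hi), hp])]
    · refine Finset.sum_eq_zero fun i hi => ?_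
      rw [if_neg (by rwa [Finset.card_insert_of_notMem (by simpa using hi)]), map_zero, smul_zero]
  rw [h, hξ]
  simp

/-- For a Fredholm tuple the space of all boundaries has finite codimension in the space of all
cycles. -/
theorem IsFredholm.exists_finiteDimensional {T : Fin n → E →L[ℂ] E} (hT : IsFredholm T) :
    ∃ F : Submodule ℂ (Total n E), FiniteDimensional ℂ F ∧
      (boundary T).ker ≤ (boundary T).range ⊔ F := by
  have hF (p : Fin (n + 1)) : ∃ F : Submodule ℂ (Total n E), FiniteDimensional ℂ F ∧
      cycles T p ≤ (boundary T).range ⊔ F := by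
    have := hT.2 p (Nat.lt_succ_iff.1 p.2)
    obtain ⟨Q, hQ⟩ := ((boundaries T p).submoduleOf (cycles T p)).exists_isCompl
    have : FiniteDimensional ℂ Q := (Submodule.quotientEquivOfIsCompl _ Q hQ).finiteDimensional
    refine ⟨Q.map (cycles T p).subtype, inferInstance, fun z hz => ?_⟩
    obtain ⟨b, hb, q, hq, h⟩ := Submodule.mem_sup.1
      (hQ.sup_eq_top ▸ Submodule.mem_top : (⟨z, hz⟩ : cycles T p) ∈ _ ⊔ Q)
    obtain ⟨η, _, hη⟩ := hb
    exact Submodule.mem_sup.2 ⟨b, ⟨η, hη⟩, q, ⟨q, hq, rfl⟩, congrArg Subtype.val h⟩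
  choose F hF1 hF2 using hF
  refine ⟨⨆ p, F p, inferInstance, fun ξ hξ => mem_of_forall_component_mem fun p => ?_⟩
  by_cases hp : p < n + 1
  · exact sup_le_sup_left (le_iSup F ⟨p, hp⟩) _ (hF2 ⟨p, hp⟩ (component_mem_cycles hξ p))
  · have h0 : (fun S => if S.card = p then ξ S else 0 : Total n E) = 0 := by
      ext S
      have hS : S.card < n + 1 := Nat.lt_succ_of_le (by simpa using S.card_le_univ)
      simp [show S.card ≠ p by omega]
    rw [h0]
    exact zero_mem _

/-- The boundary operator as a bounded operator. -/
noncomputable def boundaryL (T : Fin n → E →L[ℂ] E) : Total n E →L[ℂ] Total n E where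
  toLinearMap := boundary T
  cont := by
    refine continuous_pi fun S => ?_
    simp only [boundary]
    exact continuous_finsetSum _ fun i _ =>
      ((T i).continuous.comp (continuous_apply _)).const_smul _

/-- The range of the boundary operator of a Fredholm tuple is closed, in quantitative form. -/
theorem IsFredholm.exists_bound [CompleteSpace E] {T : Fin n → E →L[ℂ] E} (hT : IsFredholm T) :
    ∃ C > 0, ∀ ξ, ∃ η, boundary T η = boundary T ξ ∧ ‖η‖ ≤ C * ‖boundary T ξ‖ := by
  obtain ⟨F, hF, h⟩ := hT.exists_finiteDimensional
  have : CompleteSpace (boundaryL T).ker := (boundaryL T).isClosed_ker.completeSpace_coe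
  refine (boundaryL T).exists_preimage_norm_le_of_finite (boundaryL T).ker F ?_ h
  rintro _ ⟨ξ, rfl⟩
  exact boundary_boundary T hT.1 ξ

theorem norm_sum_sign_smul_le {A S : Finset (Fin n)} {F : Type*} [SeminormedAddCommGroup F]
    [NormedSpace ℂ F] (y : Fin n → F) {δ : ℝ} (hδ : 0 ≤ δ) (hy : ∀ i ∈ A, ‖y i‖ ≤ δ) :
    ‖∑ i ∈ A, (-1 : ℂ) ^ (S.filter (· < i)).card • y i‖ ≤ n * δ := by
  refine (norm_sum_le_of_le (n := fun _ => δ) A fun i hi => ?_).trans ?_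
  · rw [norm_smul, norm_pow, norm_neg, norm_one, one_pow, one_mul]
    exact hy i hi
  · rw [Finset.sum_const, nsmul_eq_mul]
    have : (A.card : ℝ) ≤ n := by exact_mod_cast (by simpa using A.card_le_univ)
    gcongr

theorem norm_boundary_single_le (T : Fin n → E →L[ℂ] E) (S : Finset (Fin n)) {x : E} {ε : ℝ}
    (hε : 0 ≤ ε) (hx : ∀ i ∈ S, ‖T i x‖ ≤ ε) : ‖boundary T (Pi.single S x)‖ ≤ n * ε := by
  refine (pi_norm_le_iff_of_nonneg (by positivity)).2 fun R => ?_
  refine norm_sum_sign_smul_le _ hε fun i hi => ?_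
  by_cases h : insert i R = S
  · subst h
    simpa using hx i (by simp)
  · simpa [Pi.single_eq_of_ne h] using hε

end

variable {n : ℕ} {E : Type*} [NormedAddCommGroup E] [InnerProductSpace ℂ E] [CompleteSpace E]

theorem norm_inner_boundary_le (T : Fin n → E →L[ℂ] E) (S : Finset (Fin n)) {x : E} {ε : ℝ}
    (hε : 0 ≤ ε) (hx : ∀ i ∉ S, ‖ContinuousLinearMap.adjoint (T i) x‖ ≤ ε) (ζ : Total n E) :
    ‖⟪x, boundary T ζ S⟫_ℂ‖ ≤ n * (ε * ‖ζ‖) := by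
  rw [boundary_apply, inner_sum]
  simp only [inner_smul_right]
  refine norm_sum_sign_smul_le (fun i => ⟪x, T i (ζ (insert i S))⟫_ℂ) (by positivity)
    fun i hi => ?_
  rw [← ContinuousLinearMap.adjoint_inner_left]
  refine (norm_inner_le_norm _ _).trans ?_
  gcongr
  · exact hx i (by simpa using hi)
  · exact norm_le_pi_norm ζ _

/-- A tuple is not Fredholm if, for some `S`, there are arbitrarily large orthonormal systems of
vectors `x` for which `x ⊗ e_S` is almost annihilated by the boundary operator and its adjoint. -/
theorem not_isFredholm_of_orthonormal {T : Fin n → E →L[ℂ] E} (S : Finset (Fin n))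
    (h : ∀ (N : ℕ) (ε : ℝ), 0 < ε → ∃ v : Fin N → E, Orthonormal ℂ v ∧ ∀ k,
      (∀ i ∈ S, ‖T i (v k)‖ ≤ ε) ∧ ∀ i ∉ S, ‖ContinuousLinearMap.adjoint (T i) (v k)‖ ≤ ε) :
    ¬ IsFredholm T := by
  intro hT
  obtain ⟨F, hF, hker⟩ := hT.exists_finiteDimensional
  obtain ⟨C, hC, hbd⟩ := hT.exists_bound
  set N := Module.finrank ℂ F + 1
  -- With this choice of `ε`, the total error `δ = N * (C * (n * ε))` below is at most `1 / 4`.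
  set ε : ℝ := 1 / (4 * (N * C * n + 1)) with hε
  have hεpos : 0 < ε := by positivity
  have hδ : N * (C * (n * ε)) ≤ 1 / 4 := by
    rw [hε, mul_one_div, mul_div_assoc', mul_div_assoc', div_le_div_iff₀ (by positivity)
      (by positivity)]
    linarith
  obtain ⟨v, hv, hTv⟩ := h N ε hεpos
  -- Correct `v k ⊗ e_S` to a cycle `z k`, at distance at most `C * (n * ε)`.
  have hη (k) : ∃ η, boundary T η = boundary T (Pi.single S (v k)) ∧ ‖η‖ ≤ C * (n * ε) := by
    obtain ⟨η, h1, h2⟩ := hbd (Pi.single S (v k))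
    refine ⟨η, h1, h2.trans ?_⟩
    gcongr
    exact norm_boundary_single_le T S hεpos.le (hTv k).1
  choose η hη1 hη2 using hη
  let z (k) : Total n E := Pi.single S (v k) - η k
  have hz (k) : z k ∈ (boundary T).ker := by simp [z, hη1]
  -- As there are more than `dim F` of them, some combination of the `z k` is a boundary.
  have hc : ∃ c : Fin N → ℂ, c ≠ 0 ∧ ∑ k, c k • z k ∈ (boundary T).range := by
    let q := (boundary T).range.mkQ
    have hq (k) : q (z k) ∈ F.map q := by
      obtain ⟨_, ⟨b, rfl⟩, f, hf, h⟩ := Submodule.mem_sup.1 (hker (hz k))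
      refine ⟨f, hf, ?_⟩
      rw [← h, map_add]
      simp [q]
    let φ : (Fin N → ℂ) →ₗ[ℂ] F.map q := Fintype.linearCombination ℂ fun k => ⟨q (z k), hq k⟩
    have hφ : φ.ker ≠ ⊥ := by
      refine LinearMap.ker_ne_bot_of_finrank_lt ?_
      rw [Module.finrank_fin_fun]
      exact (Submodule.finrank_map_le q F).trans_lt (Nat.lt_succ_self _)
    obtain ⟨c, hc, hc0⟩ := Submodule.exists_mem_ne_zero_of_ne_bot hφ
    refine ⟨c, hc0, ?_⟩
    have h0 : ((φ c : F.map q) : _ ⧸ (boundary T).range) = 0 := by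
      rw [LinearMap.mem_ker.1 hc]
      rfl
    rw [← Submodule.ker_mkQ (boundary T).range, LinearMap.mem_ker, map_sum, ← h0]
    simp [φ, Fintype.linearCombination_apply, q]
  obtain ⟨c, hc0, ξ, hξ⟩ := hc
  set x : E := ∑ k, c k • v k with hx
  have hx0 : 0 < ‖x‖ := by
    refine norm_pos_iff.2 fun h0 => hc0 (funext ?_)
    exact Fintype.linearIndependent_iff.1 hv.linearIndependent c h0
  have hcx (k) : ‖c k‖ ≤ ‖x‖ := by
    have e : ⟪v k, x⟫_ℂ = c k := hv.inner_right_fintype c k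
    rw [← e]
    simpa [hv.1 k] using norm_inner_le_norm (𝕜 := ℂ) (v k) x
  have hsum {G : Type _} [NormedAddCommGroup G] [NormedSpace ℂ G] (y : Fin N → G) {δ : ℝ}
      (hy : ∀ k, ‖y k‖ ≤ δ) : ‖∑ k, c k • y k‖ ≤ ‖x‖ * (N * δ) := by
    refine (norm_sum_le_of_le (n := fun _ => ‖x‖ * δ) _ fun k _ => ?_).trans ?_
    · rw [norm_smul]
      exact mul_le_mul (hcx k) (hy k) (norm_nonneg _) (norm_nonneg _)
    · rw [Finset.sum_const, nsmul_eq_mul, Finset.card_univ, Fintype.card_fin]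
      exact le_of_eq (by ring)
  set w : Total n E := ∑ k, c k • z k with hw
  have hwx : w = Pi.single S x - ∑ k, c k • η k := by
    have : (Pi.single S x : Total n E) = ∑ k, c k • Pi.single S (v k) := by
      ext R
      by_cases hR : R = S
      · subst hR
        simp [hx]
      · simp [hR]
    rw [this, hw, ← Finset.sum_sub_distrib]
    simp [z, smul_sub]
  set δ : ℝ := N * (C * (n * ε)) with hδ'
  have hηsum : ‖∑ k, c k • η k‖ ≤ ‖x‖ * δ := hsum η hη2
  have hwnorm : ‖w‖ ≤ ‖x‖ * (1 + δ) := by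
    rw [hwx]
    refine (norm_sub_le _ _).trans ?_
    rw [Pi.norm_single]
    linarith
  -- The boundary `w` is close to `x ⊗ e_S`, but almost orthogonal to it.
  obtain ⟨ζ, hζ1, hζ2⟩ := hbd ξ
  rw [hξ] at hζ1 hζ2
  have hadj : ∀ i ∉ S, ‖ContinuousLinearMap.adjoint (T i) x‖ ≤ ‖x‖ * (N * ε) := by
    intro i hi
    simp only [hx, map_sum, map_smul]
    rw [← hx]
    exact hsum _ fun k => (hTv k).2 i hi
  have hup : ‖⟪x, w S⟫_ℂ‖ ≤ ‖x‖ ^ 2 * (δ * (1 + δ)) := by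
    rw [← hζ1]
    refine (norm_inner_boundary_le T S (by positivity) hadj ζ).trans ?_
    have : ‖ζ‖ ≤ C * (‖x‖ * (1 + δ)) := hζ2.trans (by gcongr)
    calc n * (‖x‖ * (N * ε) * ‖ζ‖) ≤ n * (‖x‖ * (N * ε) * (C * (‖x‖ * (1 + δ)))) := by gcongr
      _ = ‖x‖ ^ 2 * (δ * (1 + δ)) := by rw [hδ']; ring
  have hlow : ‖x‖ ^ 2 * (1 - δ) ≤ ‖⟪x, w S⟫_ℂ‖ := by
    have e : ⟪x, w S⟫_ℂ = (‖x‖ : ℂ) ^ 2 - ⟪x, (∑ k, c k • η k : Total n E) S⟫_ℂ := by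
      rw [hwx, Pi.sub_apply, Pi.single_eq_same, inner_sub_right]
      congr 1
      exact inner_self_eq_norm_sq_to_K x
    have h1 : ‖⟪x, (∑ k, c k • η k : Total n E) S⟫_ℂ‖ ≤ ‖x‖ * (‖x‖ * δ) := by
      refine (norm_inner_le_norm _ _).trans ?_
      gcongr
      exact (norm_le_pi_norm _ S).trans hηsum
    have h2 := norm_sub_norm_le ((‖x‖ : ℂ) ^ 2) ⟪x, (∑ k, c k • η k : Total n E) S⟫_ℂ
    rw [← e, norm_pow, Complex.norm_real, norm_norm] at h2
    linarith
  have hδ0 : 0 ≤ δ := by positivity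
  have := le_of_mul_le_mul_left (hlow.trans hup) (by positivity : 0 < ‖x‖ ^ 2)
  nlinarith

end Koszul

/-! ### Tuples of operators on different tensor factors -/

namespace HilbertTensor

variable {n : ℕ} {H : Fin n → Type*} [∀ i, NormedAddCommGroup (H i)]
  [∀ i, InnerProductSpace ℂ (H i)]

theorem commute_site_site (A : ∀ i, H i →L[ℂ] H i) (i j : Fin n) :
    Commute (site i (A i)) (site j (A j)) := by
  by_cases h : i = j
  · subst h
    exact Commute.refl _
  · exact commute_site h _ _

section Fredholm

variable {T G : ∀ i, H i →L[ℂ] H i} (hG : ∀ i, T i * G i * T i = T i)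
include hG

theorem site_mul_mul (i : Fin n) :
    site i (T i) * site i (G i) * site i (T i) = site i (T i) := by
  rw [← site_mul, ← site_mul, hG]

/-- The harmonic vectors at `S` are those fixed by the projections onto `ker (T i)`, for `i ∈ S`, and
onto a complement of the range of `T i`, for `i ∉ S`. -/
theorem harmonicAt_site (S : Finset (Fin n)) :
    Koszul.harmonicAt (fun i => site i (T i)) (fun i => site i (G i)) S =
      fixed fun i => if i ∈ S then 1 - G i * T i else 1 - T i * G i := by
  ext z
  rw [mem_fixed, Koszul.mem_harmonicAt]
  refine forall_congr' fun i => ?_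
  split_ifs with h
  · have hz : site i (T i) (site i (G i) (site i (T i) z)) = site i (T i) z :=
      congrArg (fun A => A z) (site_mul_mul hG i)
    rw [site_sub, site_one, site_mul]
    simp only [sub_apply, mul_apply_eq_comp, one_apply_eq_self, sub_eq_self]
    exact ⟨fun h => by rw [h, map_zero], fun h => by rw [← hz, h, map_zero]⟩
  · rw [site_sub, site_one, site_mul]
    simp only [sub_apply, mul_apply_eq_comp, one_apply_eq_self, sub_eq_self]

/-- The Künneth formula, one summand at a time: the harmonic vectors at `S` form the tensor product
of the kernels of `T i`, `i ∈ S`, and of the cokernels of `T i`, `i ∉ S`. -/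
theorem finrank_harmonicAt_site (hT : ∀ i, (T i).IsFredholm) (S : Finset (Fin n)) :
    FiniteDimensional ℂ (Koszul.harmonicAt (fun i => site i (T i)) (fun i => site i (G i)) S) ∧
      Module.finrank ℂ
        (Koszul.harmonicAt (fun i => site i (T i)) (fun i => site i (G i)) S) =
        ∏ i, if i ∈ S then Module.finrank ℂ (T i).ker
          else Module.finrank ℂ (H i ⧸ (T i).range) := by
  rw [harmonicAt_site hG]
  set p : ∀ i, H i →L[ℂ] H i := fun i => if i ∈ S then 1 - G i * T i else 1 - T i * G i
  have hidem (i) : IsIdempotentElem (p i) := by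
    by_cases hi : i ∈ S
    · rw [show p i = 1 - G i * T i from if_pos hi]
      exact ContinuousLinearMap.isIdempotentElem_one_sub_mul_left (hG i)
    · rw [show p i = 1 - T i * G i from if_neg hi]
      exact ContinuousLinearMap.isIdempotentElem_one_sub_mul_right (hG i)
  have hdim (i) : FiniteDimensional ℂ (p i).range ∧ Module.finrank ℂ (p i).range =
      if i ∈ S then Module.finrank ℂ (T i).ker else Module.finrank ℂ (H i ⧸ (T i).range) := by
    by_cases hi : i ∈ S
    · rw [show p i = 1 - G i * T i from if_pos hi, if_pos hi,
        ContinuousLinearMap.range_one_sub_mul_left (hG i)]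
      exact ⟨(hT i).finite_ker, rfl⟩
    · rw [show p i = 1 - T i * G i from if_neg hi, if_neg hi]
      obtain ⟨e⟩ := ContinuousLinearMap.nonempty_quotient_range_equiv (hG i)
      have : FiniteDimensional ℂ (H i ⧸ (T i).range) := (hT i).finite_coker
      exact ⟨e.finiteDimensional, e.finrank_eq.symm⟩
  have := fun i => (hdim i).1
  refine ⟨(finrank_fixed p hidem).1, (finrank_fixed p hidem).2.trans ?_⟩
  exact Finset.prod_congr rfl fun i _ => (hdim i).2

end Fredholm

theorem isFredholm_site {T : ∀ i, H i →L[ℂ] H i} (hT : ∀ i, (T i).IsFredholm) :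
    Koszul.IsFredholm (fun i => site i (T i)) ∧
      Koszul.index (fun i => site i (T i)) =
        (-1) ^ (n + 1) * ∏ i, (T i : H i →ₗ[ℂ] H i).index := by
  choose G hG using fun i => (hT i).exists_mul_mul_eq
  have hTT := commute_site_site T
  have hGG := commute_site_site G
  have hTG (i j : Fin n) (h : i ≠ j) : Commute (site i (T i)) (site j (G j)) :=
    commute_site h _ _
  have := fun S => (finrank_harmonicAt_site hG hT S).1
  refine ⟨⟨hTT, fun p _ => Koszul.finiteDimensional_homology hTT hGG hTG (site_mul_mul hG) p⟩, ?_⟩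
  rw [Koszul.index_eq_sum hTT hGG hTG (site_mul_mul hG)]
  simp_rw [fun S => (finrank_harmonicAt_site hG hT S).2, LinearMap.index_eq_finrank_sub]
  -- Expand `∏ (dim ker - dim coker) = (-1) ^ n * ∏ (-dim ker + dim coker)`.
  have hneg : ∏ i, ((Module.finrank ℂ (T i).ker : ℤ) - Module.finrank ℂ (H i ⧸ (T i).range)) =
      (-1) ^ n * ∏ i, (-(Module.finrank ℂ (T i).ker : ℤ) +
        Module.finrank ℂ (H i ⧸ (T i).range)) := by
    rw [← Fin.prod_const, ← Finset.prod_mul_distrib]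
    exact Finset.prod_congr rfl fun i _ => by ring
  rw [hneg, Fintype.prod_add, ← mul_assoc, ← pow_add, show n + 1 + n = 2 * n + 1 by ring,
    pow_succ, pow_mul, neg_one_sq, one_pow, one_mul, Finset.mul_sum]
  refine Finset.sum_congr rfl fun S _ => ?_
  have hS : (Finset.univ.filter fun i => i ∉ S) = Sᶜ := by
    ext i
    simp
  rw [Nat.cast_prod]
  simp_rw [Nat.cast_ite]
  rw [Finset.prod_ite, Finset.filter_mem_eq_inter, Finset.univ_inter, hS, Finset.prod_neg,
    pow_succ]
  ring

theorem orthonormal_update [DecidableEq (Fin n)] (i : Fin n) {x : ∀ j, H j}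
    (hx : ∀ j, j ≠ i → ‖x j‖ = 1) {N : ℕ} {y : Fin N → H i} (hy : Orthonormal ℂ y) :
    Orthonormal ℂ fun k => tmul (Function.update x i (y k)) := by
  rw [orthonormal_iff_ite] at hy ⊢
  intro k l
  rw [inner_tmul, Fintype.prod_eq_mul_prod_compl i, Function.update_self, Function.update_self,
    hy, Finset.prod_eq_one, mul_one]
  intro j hj
  have hj : j ≠ i := by simpa using hj
  simp [hj, hx j hj]

variable [∀ i, CompleteSpace (H i)]

/-- If some `T i₀` is not Fredholm, tensor products of approximate null vectors of the `T i` or of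
their adjoints, with infinitely many independent ones at `i₀`, show that the tuple is not
Fredholm. -/
theorem isFredholm_of_isFredholm_site {T : ∀ i, H i →L[ℂ] H i} (hT : ∀ i, ¬ IsUnit (T i))
    (h : Koszul.IsFredholm fun i => site i (T i)) (i₀ : Fin n) : (T i₀).IsFredholm := by
  classical
  by_contra hi₀
  -- `S` collects the sites at which `T i`, rather than its adjoint, is not bounded below.
  obtain ⟨S, h₀, h₀', hS, hS'⟩ : ∃ S : Finset (Fin n),
      (i₀ ∈ S → (T i₀).IsEssentiallyNotBoundedBelow) ∧
      (i₀ ∉ S → (ContinuousLinearMap.adjoint (T i₀)).IsEssentiallyNotBoundedBelow) ∧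
      (∀ i ∈ S, (T i).IsNotBoundedBelow) ∧
      ∀ i ∉ S, (ContinuousLinearMap.adjoint (T i)).IsNotBoundedBelow := by
    have h1 (i) : ¬ (T i).IsNotBoundedBelow →
        (ContinuousLinearMap.adjoint (T i)).IsNotBoundedBelow := fun h1 => by
      by_contra h2
      exact hT i (ContinuousLinearMap.isUnit_of_bounded_below h1 h2)
    by_cases hess : (T i₀).IsEssentiallyNotBoundedBelow
    · refine ⟨Finset.univ.filter fun i => (T i).IsNotBoundedBelow, fun _ => hess, fun hn => ?_,
        by simp, by simpa using h1⟩
      exact absurd hess.isNotBoundedBelow (by simpa using hn)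
    · have hess' : (ContinuousLinearMap.adjoint (T i₀)).IsEssentiallyNotBoundedBelow := by
        by_contra h2
        exact hi₀ (ContinuousLinearMap.isFredholm_of_bounded_below hess h2)
      refine ⟨Finset.univ.filter fun i => i ≠ i₀ ∧ (T i).IsNotBoundedBelow, by simp,
        fun _ => hess', by simp, fun i hi => ?_⟩
      by_cases hii : i = i₀
      · exact hii ▸ hess'.isNotBoundedBelow
      · exact h1 i (by simpa [hii] using hi)
  refine Koszul.not_isFredholm_of_orthonormal S (fun N ε hε => ?_) h
  have hx (i) : ∃ x : H i, ‖x‖ = 1 ∧ (i ∈ S → ‖T i x‖ ≤ ε) ∧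
      (i ∉ S → ‖ContinuousLinearMap.adjoint (T i) x‖ ≤ ε) := by
    by_cases hi : i ∈ S
    · obtain ⟨x, h1, h2⟩ := hS i hi ε hε
      exact ⟨x, h1, fun _ => h2, fun h => absurd hi h⟩
    · obtain ⟨x, h1, h2⟩ := hS' i hi ε hε
      exact ⟨x, h1, fun h => absurd h hi, fun _ => h2⟩
  choose x hx1 hx2 hx3 using hx
  obtain ⟨y, hy, hy2, hy3⟩ : ∃ y : Fin N → H i₀, Orthonormal ℂ y ∧
      (i₀ ∈ S → ∀ k, ‖T i₀ (y k)‖ ≤ ε) ∧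
      (i₀ ∉ S → ∀ k, ‖ContinuousLinearMap.adjoint (T i₀) (y k)‖ ≤ ε) := by
    by_cases hi : i₀ ∈ S
    · obtain ⟨y, h1, h2⟩ := (h₀ hi).exists_orthonormal hε N
      exact ⟨y, h1, fun _ => h2, fun h => absurd hi h⟩
    · obtain ⟨y, h1, h2⟩ := (h₀' hi).exists_orthonormal hε N
      exact ⟨y, h1, fun h => absurd h hi, fun _ => h2⟩
  have hnorm (k : Fin N) (i) : ‖Function.update x i₀ (y k) i‖ = 1 := by
    by_cases hi : i = i₀
    · subst hi
      simp [hy.1 k]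
    · simp [hi, hx1]
  have hsite (k : Fin N) (i) (A : H i →L[ℂ] H i)
      (hA : ‖A (Function.update x i₀ (y k) i)‖ ≤ ε) :
      ‖site i A (tmul (Function.update x i₀ (y k)))‖ ≤ ε := by
    rw [site_tmul, norm_tmul, Fintype.prod_eq_mul_prod_compl i, Function.update_self,
      Finset.prod_eq_one, mul_one]
    · exact hA
    · intro j hj
      have hj : j ≠ i := by simpa using hj
      rw [Function.update_of_ne hj, hnorm]
  refine ⟨_, orthonormal_update i₀ (fun j _ => hx1 j) hy, fun k => ⟨fun i hi => ?_, fun i hi => ?_⟩⟩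
  · refine hsite k i _ ?_
    by_cases hii : i = i₀
    · subst hii
      simpa using hy2 hi k
    · simpa [hii] using hx2 i hi
  · rw [adjoint_site]
    refine hsite k i _ ?_
    by_cases hii : i = i₀
    · subst hii
      simpa using hy3 hi k
    · simpa [hii] using hx3 i hi

end HilbertTensor

theorem lemma3p2 {n : ℕ} (H : Fin n → Type*) [∀ i, NormedAddCommGroup (H i)]
    [∀ i, InnerProductSpace ℂ (H i)] [∀ i, CompleteSpace (H i)]
    (hH : ∀ i, ¬ FiniteDimensional ℂ (H i))
    (T : ∀ i, H i →L[ℂ] H i) (hT : ∀ i, ¬ IsUnit (T i)) :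
    (Koszul.IsFredholm (fun i => HilbertTensor.site i (T i)) ↔ ∀ i, (T i).IsFredholm) ∧
    (Koszul.IsFredholm (fun i => HilbertTensor.site i (T i)) →
      Koszul.index (fun i => HilbertTensor.site i (T i)) =
        (-1) ^ (n + 1) * ∏ i, (T i : H i →ₗ[ℂ] H i).index) :=
  ⟨⟨HilbertTensor.isFredholm_of_isFredholm_site hT, fun h => (HilbertTensor.isFredholm_site h).1⟩,
    fun h => (HilbertTensor.isFredholm_site
      (HilbertTensor.isFredholm_of_isFredholm_site hT h)).2⟩
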